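/- For a positive integer $n$, let $R(n)$ denote the largest cardinality of a family $\mathcal G$ of (simple, not necessarily connected) graphs on the vertex set $[n]=\{1,\dots,n\}$ such that every vertex has degree $2$ in each member of $\mathcal G$, and such that the union of any two different members of $\mathcal G$ has maximum degree at least $4$ (equivalently, exactly $4$); here the union of two graphs on $[n]$ is the graph on $[n]$ whose edge set is the union of their edge sets. Then $$ R(n)\;\le\; e^{\sqrt{n}}\,\frac{n!}{\lfloor n/3\rfloor!}\qquad\text{for every } n\ge 1,$$ and there is an absolute constant $c>0$ such that $$ c\cdot\frac{n!}{\lfloor n/3\rfloor!\;6^{n/3}}\;\le\; R(n)\qquad\text{for every } n\ge 3 .$$ Moreover, if $n$ is a multiple of $3$, the last inequality holds with $c=1$. -/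

import Mathlib

/-- For families `F` and `D` of graphs on the vertex set `Fin n`, the largest cardinality of a
subfamily of `F` in which the union of any two different members belongs to `D`. -/
noncomputable def maxFamily (n : ℕ) (F D : Set (SimpleGraph (Fin n))) : ℕ :=
  sSup {m : ℕ | ∃ G : Finset (SimpleGraph (Fin n)),
    (G : Set (SimpleGraph (Fin n))) ⊆ F ∧
    (∀ A ∈ G, ∀ B ∈ G, A ≠ B → A ⊔ B ∈ D) ∧ G.card = m}

/-- The supremum in `maxFamily` is attained: it is a maximum. -/
theorem maxFamily_isGreatest (n : ℕ) (F D : Set (SimpleGraph (Fin n))) :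
    IsGreatest {m : ℕ | ∃ G : Finset (SimpleGraph (Fin n)),
      (G : Set (SimpleGraph (Fin n))) ⊆ F ∧
      (∀ A ∈ G, ∀ B ∈ G, A ≠ B → A ⊔ B ∈ D) ∧ G.card = m} (maxFamily n F D) := by
  classical
  have hb : BddAbove {m : ℕ | ∃ G : Finset (SimpleGraph (Fin n)),
      (G : Set (SimpleGraph (Fin n))) ⊆ F ∧
      (∀ A ∈ G, ∀ B ∈ G, A ≠ B → A ⊔ B ∈ D) ∧ G.card = m} := by
    refine ⟨Fintype.card (SimpleGraph (Fin n)), ?_⟩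
    rintro m ⟨G, -, -, rfl⟩
    exact Finset.card_le_univ G
  exact ⟨Nat.sSup_mem ⟨0, ∅, by simp, by simp, by simp⟩ hb, fun m hm => le_csSup hb hm⟩

open Classical in
/-- The graphs on `Fin n` of uniform degree 2 (not necessarily connected). -/
def twoRegularGraphs (n : ℕ) : Set (SimpleGraph (Fin n)) :=
  {G | G.IsRegularOfDegree 2}

open Classical in
/-- The graphs on `Fin n` of maximum degree at least 4. -/
def maxDegreeAtLeastFour (n : ℕ) : Set (SimpleGraph (Fin n)) :=
  {G | 4 ≤ G.maxDegree}

/-- `R n` is the largest cardinality of a family of 2-regular graphs on `n` vertices in which the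
union of any two different members has a vertex of degree 4. -/
noncomputable def R (n : ℕ) : ℕ :=
  maxFamily n (twoRegularGraphs n) (maxDegreeAtLeastFour n)

open SimpleGraph

/-! Two 2-regular graphs conflict when they share a neighbor at every vertex; the family must be
conflict-free.

Upper bound: a minimal edge cover of a 2-regular graph is a disjoint union of stars with one or two
leaves. Graphs with a common cover conflict, so members of the family have distinct covers. Covers
with `t` two-leaf stars and `s` edges number at most `n! / (t! s! 2^t 2^s) ≤ n! / (t+s)! ≤ n! /
⌊n/3⌋!`, and `t` takes at most `⌊n/3⌋ + 1 ≤ e^√n` values.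

Lower bound: take a maximal conflict-free set of labelings of `k` triangles and `r` 4-cycles. By
maximality every labeling conflicts with one in the set. A conflict forces the permutation between
two labelings to carry triangles to triangles, so each labeling conflicts with at most `k! 6^k
(4r)!` others, itself included. With `r ≤ 2` the last factor is bounded, and it is 1 when `3 ∣ n`.
-/

theorem mem_twoRegularGraphs {n : ℕ} {G : SimpleGraph (Fin n)} :
    G ∈ twoRegularGraphs n ↔ ∀ v, (G.neighborSet v).ncard = 2 := by
  classical
  simp only [twoRegularGraphs, Set.mem_ofPred_eq, IsRegularOfDegree]
  refine forall_congr' fun v => ?_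
  rw [← card_neighborSet_eq_degree, ← Nat.card_eq_fintype_card, Nat.card_coe_set_eq]

theorem mem_maxDegreeAtLeastFour {n : ℕ} {G : SimpleGraph (Fin n)} :
    G ∈ maxDegreeAtLeastFour n ↔ ∃ v, 4 ≤ (G.neighborSet v).ncard := by
  classical
  have key : ∀ v, (G.neighborSet v).ncard = G.degree v := fun v => by
    rw [← card_neighborSet_eq_degree, ← Nat.card_eq_fintype_card, Nat.card_coe_set_eq]
  simp only [maxDegreeAtLeastFour, Set.mem_ofPred_eq, key]
  constructor
  · intro h
    by_contra! hc
    have := G.maxDegree_le_of_forall_degree_le 3 fun v => Nat.le_of_lt_succ (hc v)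
    have h' : 4 ≤ G.maxDegree := by convert h
    omega
  · rintro ⟨v, hv⟩
    have := hv.trans (G.degree_le_maxDegree v)
    convert this

/-- The union of two 2-regular graphs has a vertex of degree 4 exactly when the two graphs have
disjoint neighborhoods at some vertex. -/
theorem sup_mem_maxDegreeAtLeastFour {n : ℕ} {A B : SimpleGraph (Fin n)}
    (hA : A ∈ twoRegularGraphs n) (hB : B ∈ twoRegularGraphs n) :
    A ⊔ B ∈ maxDegreeAtLeastFour n ↔ ∃ v, ∀ u, ¬(A.Adj v u ∧ B.Adj v u) := by
  rw [mem_maxDegreeAtLeastFour]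
  rw [mem_twoRegularGraphs] at hA hB
  refine exists_congr fun v => ?_
  have hs : (A ⊔ B).neighborSet v = A.neighborSet v ∪ B.neighborSet v := rfl
  have h := Set.ncard_union_add_ncard_inter (A.neighborSet v) (B.neighborSet v)
  rw [hA, hB] at h
  have h0 : (A.neighborSet v ∩ B.neighborSet v).ncard = 0 ↔
      ∀ u, ¬(A.Adj v u ∧ B.Adj v u) := by
    rw [Set.ncard_eq_zero, Set.eq_empty_iff_forall_notMem]; rfl
  rw [← h0, hs]
  omega

/-! ### Upper bound: covers by short stars -/

/-- A spanning graph of stars with one or two leaves. -/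
structure IsShortStarCover {V : Type*} (H : SimpleGraph V) : Prop where
  exists_adj : ∀ v, ∃ u, H.Adj v u
  ncard_le : ∀ v, (H.neighborSet v).ncard ≤ 2
  leaf : ∀ u v, H.Adj u v → (H.neighborSet u).ncard = 1 ∨ (H.neighborSet v).ncard = 1

/-- A minimal edge cover of a graph of maximum degree 2 consists of short stars. -/
theorem exists_isShortStarCover_le {V : Type*} [Finite V] (G : SimpleGraph V)
    (hG : ∀ v, ∃ u, G.Adj v u) (hd : ∀ v, (G.neighborSet v).ncard ≤ 2) :
    ∃ H ≤ G, IsShortStarCover H := by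
  classical
  obtain ⟨H, hH⟩ := (Set.toFinite {H : SimpleGraph V | H ≤ G ∧ ∀ v, ∃ u, H.Adj v u}).exists_minimal
    ⟨G, le_rfl, hG⟩
  obtain ⟨hHG, hHc⟩ := hH.prop
  refine ⟨H, hHG, hHc, fun v => (Set.ncard_le_ncard (fun u hu => hHG hu)).trans (hd v), ?_⟩
  intro u v huv
  by_contra! hc
  have other : ∀ x y, H.Adj x y → (H.neighborSet x).ncard ≠ 1 → ∃ z, H.Adj x z ∧ z ≠ y := by
    intro x y hxy h1
    by_contra! hz
    exact h1 (Set.ncard_eq_one.2 ⟨y, Set.ext fun z => ⟨fun h => hz z h, by rintro rfl; exact hxy⟩⟩)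
  -- If both ends of `uv` had another neighbor, deleting `uv` would leave a smaller cover, against
  -- minimality.
  have hle : H ≤ H.deleteEdges {s(u, v)} := by
    refine hH.le_of_le ⟨(deleteEdges_le _).trans hHG, fun w => ?_⟩ (deleteEdges_le _)
    simp only [deleteEdges_adj, Set.mem_singleton_iff, Sym2.eq_iff]
    by_cases hwu : w = u
    · subst hwu
      obtain ⟨z, hz, hzv⟩ := other w v huv hc.1
      exact ⟨z, hz, by have := huv.ne; tauto⟩
    by_cases hwv : w = v
    · subst hwv
      obtain ⟨z, hz, hzv⟩ := other w u huv.symm hc.2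
      exact ⟨z, hz, by have := huv.ne; tauto⟩
    obtain ⟨z, hz⟩ := hHc w
    exact ⟨z, hz, by tauto⟩
  have := hle huv
  simp at this

/-- The disjoint union of two-leaf stars indexed by `α` and edges indexed by `β`. -/
def starForest (α β : Type*) : SimpleGraph (α × Option Bool ⊕ β × Bool) where
  Adj
    | .inl p, .inl q => p.1 = q.1 ∧ p.2.isNone ≠ q.2.isNone
    | .inr p, .inr q => p.1 = q.1 ∧ p.2 ≠ q.2
    | _, _ => False
  symm := ⟨by rintro (p | p) (q | q) h <;> simp_all [eq_comm]⟩
  loopless := ⟨by rintro (p | p) <;> simp⟩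

theorem IsShortStarCover.exists_iso_starForest {V : Type*} [Fintype V] [LinearOrder V]
    {H : SimpleGraph V} (hH : IsShortStarCover H) :
    ∃ t s : ℕ, Nonempty (starForest (Fin t) (Fin s) ≃g H) := by
  classical
  let T := {v : V // (H.neighborSet v).ncard = 2}
  -- The order on `V` selects one end of each single-edge component; `T` holds the centers of the
  -- two-leaf stars.
  let S := {v : V // ∃ u, H.Adj v u ∧ v < u ∧ (H.neighborSet v).ncard = 1 ∧
    (H.neighborSet u).ncard = 1}
  let eT := Fintype.equivFin T
  let eS := Fintype.equivFin S
  have uniq : ∀ x y z, (H.neighborSet x).ncard = 1 → H.Adj x y → H.Adj x z → y = z := by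
    intro x y z h hy hz
    obtain ⟨a, ha⟩ := Set.ncard_eq_one.1 h
    have h1 : y ∈ H.neighborSet x := hy
    have h2 : z ∈ H.neighborSet x := hz
    rw [ha] at h1 h2
    exact h1.trans h2.symm
  have hnb : ∀ v : T, ∃ f : Bool → V, Function.Injective f ∧ ∀ x, H.Adj v x ↔ ∃ b, f b = x := by
    rintro ⟨v, hv⟩
    obtain ⟨a, b, hab, h⟩ := Set.ncard_eq_two.1 hv
    refine ⟨fun c => cond c a b, ?_, fun x => ?_⟩
    · rintro (_ | _) (_ | _) h <;> simp_all
    · rw [← mem_neighborSet, h]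
      simp [or_comm, eq_comm]
  choose nb nb_inj nb_adj using hnb
  have hS : ∀ v : S, ∃ u, H.Adj v u ∧ v.1 < u ∧ (H.neighborSet v).ncard = 1 ∧
    (H.neighborSet u).ncard = 1 := fun v => v.2
  choose q q_adj q_lt q_one q_one' using hS
  have nb_adj' : ∀ v b, H.Adj v.1 (nb v b) := fun v b => (nb_adj v _).2 ⟨b, rfl⟩
  have nb_one : ∀ v b, (H.neighborSet (nb v b)).ncard = 1 := fun v b => by
    have h2 := v.2
    rcases hH.leaf _ _ (nb_adj' v b) with h | h
    · omega
    · exact h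
  let g : Fin (Fintype.card T) × Option Bool ⊕ Fin (Fintype.card S) × Bool → V := fun w =>
    match w with
    | .inl (i, none) => (eT.symm i).1
    | .inl (i, some b) => nb (eT.symm i) b
    | .inr (j, false) => (eS.symm j).1
    | .inr (j, true) => q (eS.symm j)
  have g_inj : Function.Injective g := by
    have two_ne : ∀ (v : T) x, (H.neighborSet x).ncard = 1 → v.1 ≠ x := by
      rintro v x hx rfl
      have := v.2
      omega
    have hns : ∀ (v : T) b (u : S), nb v b ≠ u.1 := fun v b u h =>
      two_ne v _ (q_one' u) (uniq _ _ _ (nb_one v b) (nb_adj' v b).symm (h ▸ q_adj u))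
    have hnq : ∀ (v : T) b (u : S), nb v b ≠ q u := fun v b u h =>
      two_ne v _ (q_one u) (uniq _ _ _ (nb_one v b) (nb_adj' v b).symm (h ▸ (q_adj u).symm))
    have hsq : ∀ u u' : S, u.1 ≠ q u' := fun u u' h => by
      have h1 : q u = u'.1 := uniq _ _ _ (q_one u) (q_adj u) (h ▸ (q_adj u').symm)
      have h2 := q_lt u
      have h3 := q_lt u'
      rw [h1, h] at h2
      exact lt_asymm h2 h3
    rintro (⟨i, _ | b⟩ | ⟨j, _ | _⟩) (⟨i', _ | b'⟩ | ⟨j', _ | _⟩) h <;> simp only [g] at h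
    · simpa using eT.symm.injective (Subtype.ext h)
    · exact absurd h (two_ne _ _ (nb_one _ _))
    · exact absurd h (two_ne _ _ (q_one _))
    · exact absurd h (two_ne _ _ (q_one' _))
    · exact absurd h.symm (two_ne _ _ (nb_one _ _))
    · have h1 : (eT.symm i).1 = (eT.symm i').1 :=
        uniq _ _ _ (nb_one _ b) (nb_adj' _ b).symm (h ▸ (nb_adj' _ b').symm)
      obtain rfl := eT.symm.injective (Subtype.ext h1)
      rw [nb_inj _ h]
    · exact absurd h (hns _ _ _)
    · exact absurd h (hnq _ _ _)
    · exact absurd h.symm (two_ne _ _ (q_one _))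
    · exact absurd h.symm (hns _ _ _)
    · simpa using eS.symm.injective (Subtype.ext h)
    · exact absurd h (hsq _ _)
    · exact absurd h.symm (two_ne _ _ (q_one' _))
    · exact absurd h.symm (hnq _ _ _)
    · exact absurd h.symm (hsq _ _)
    · have h1 : (eS.symm j).1 = (eS.symm j').1 :=
        uniq _ _ _ (q_one' _) (q_adj _).symm (h ▸ (q_adj _).symm)
      obtain rfl := eS.symm.injective (Subtype.ext h1)
      rfl
  -- Lifting edges also gives surjectivity of `g`, as `H` has no isolated vertex.
  have lift : ∀ x y, H.Adj x y → ∃ w w', (starForest _ _).Adj w w' ∧ g w = x ∧ g w' = y := by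
    have hdeg : ∀ x, (H.neighborSet x).ncard = 1 ∨ (H.neighborSet x).ncard = 2 := fun x => by
      have h1 := hH.ncard_le x
      have h2 : 0 < (H.neighborSet x).ncard := (Set.ncard_pos).2 (hH.exists_adj x)
      omega
    have lift2 : ∀ x y, H.Adj x y → (H.neighborSet x).ncard = 2 →
        ∃ w w', (starForest _ _).Adj w w' ∧ g w = x ∧ g w' = y := by
      intro x y hxy hx
      obtain ⟨b, hb⟩ := (nb_adj ⟨x, hx⟩ y).1 hxy
      exact ⟨.inl (eT ⟨x, hx⟩, none), .inl (eT ⟨x, hx⟩, some b), by simp [starForest],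
        by simp [g], by simp [g, hb]⟩
    have lift1 : ∀ x y, H.Adj x y → (H.neighborSet x).ncard = 1 → (H.neighborSet y).ncard = 1 →
        x < y → ∃ w w', (starForest _ _).Adj w w' ∧ g w = x ∧ g w' = y := by
      intro x y hxy hx hy hlt
      refine ⟨.inr (eS ⟨x, y, hxy, hlt, hx, hy⟩, false), .inr (eS ⟨x, y, hxy, hlt, hx, hy⟩, true),
        by simp [starForest], by simp [g], ?_⟩
      simp only [g, Equiv.symm_apply_apply]
      exact uniq _ _ _ hx (q_adj ⟨x, _⟩) hxy
    have swap : ∀ x y, (∃ w w', (starForest _ _).Adj w w' ∧ g w = x ∧ g w' = y) →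
        ∃ w w', (starForest _ _).Adj w w' ∧ g w = y ∧ g w' = x := by
      rintro x y ⟨w, w', h, h1, h2⟩
      exact ⟨w', w, h.symm, h2, h1⟩
    intro x y hxy
    rcases hdeg x with hx | hx
    · rcases hdeg y with hy | hy
      · rcases lt_trichotomy x y with h | h | h
        · exact lift1 x y hxy hx hy h
        · exact absurd h hxy.ne
        · exact swap _ _ (lift1 y x hxy.symm hy hx h)
      · exact swap _ _ (lift2 y x hxy.symm hy)
    · exact lift2 x y hxy hx
  have g_surj : Function.Surjective g := fun x => by
    obtain ⟨y, hy⟩ := hH.exists_adj x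
    obtain ⟨w, -, -, h, -⟩ := lift x y hy
    exact ⟨w, h⟩
  refine ⟨Fintype.card T, Fintype.card S, ⟨⟨Equiv.ofBijective g ⟨g_inj, g_surj⟩, ?_⟩⟩⟩
  intro w w'
  change H.Adj (g w) (g w') ↔ _
  constructor
  · intro h
    obtain ⟨z, z', hz, h1, h2⟩ := lift _ _ h
    rwa [← g_inj h1, ← g_inj h2]
  · rintro h
    rcases w with ⟨i, _ | b⟩ | ⟨j, _ | _⟩ <;> rcases w' with ⟨i', _ | b'⟩ | ⟨j', _ | _⟩ <;>
      simp [starForest] at h <;> subst h <;> simp only [g]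
    · exact nb_adj' _ _
    · exact (nb_adj' _ _).symm
    · exact q_adj _
    · exact (q_adj _).symm

/-! ### Counting star covers by their automorphisms -/

/-- Distinct graphs isomorphic to `F` have disjoint sets of labelings by `F`, each as large as the
automorphism group of `F`. -/
theorem card_mul_card_le_factorial {W V X : Type*} [Fintype V] [Fintype X]
    {F : SimpleGraph W} {φ : X → (F ≃g F)} (hφ : Function.Injective φ)
    (𝒮 : Finset (SimpleGraph V)) (h𝒮 : ∀ H ∈ 𝒮, Nonempty (F ≃g H)) :
    𝒮.card * Fintype.card X ≤ (Fintype.card V).factorial := by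
  classical
  rcases 𝒮.eq_empty_or_nonempty with rfl | ⟨H₀, h₀⟩
  · simp
  have e₀ : W ≃ V := (h𝒮 H₀ h₀).some.toEquiv
  have : Nonempty (W ≃ V) := ⟨e₀⟩
  have : Fintype W := Fintype.ofEquiv _ e₀.symm
  choose! f hf using fun H (h : H ∈ 𝒮) =>
    (h𝒮 H h).elim fun e => (⟨e.toEquiv, fun w w' => e.map_rel_iff⟩ :
      ∃ f : W ≃ V, ∀ w w', H.Adj (f w) (f w') ↔ F.Adj w w')
  rw [← Fintype.card_equiv e₀.symm, Fintype.card_congr (Equiv.symmEquiv V W), ← Fintype.card_coe, ← Fintype.card_prod]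
  -- A labeling of the form `f H ∘ φ x` determines `H` by transport of `F`, and then `φ x`.
  refine Fintype.card_le_of_injective (fun p : 𝒮 × X => (φ p.2).toEquiv.trans (f p.1)) ?_
  rintro ⟨⟨H, h⟩, x⟩ ⟨⟨H', h'⟩, x'⟩ heq
  have hev : ∀ w, f H (φ x w) = f H' (φ x' w) := fun w => DFunLike.congr_fun heq w
  have hHH : H = H' := by
    ext a b
    obtain ⟨w, rfl⟩ := ((φ x).toEquiv.trans (f H)).surjective a
    obtain ⟨w', rfl⟩ := ((φ x).toEquiv.trans (f H)).surjective b
    change H.Adj (f H (φ x w)) (f H (φ x w')) ↔ H'.Adj (f H (φ x w)) (f H (φ x w'))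
    rw [hf H h, hev, hev, hf H' h', (φ x).map_rel_iff, (φ x').map_rel_iff]
  subst hHH
  have : φ x = φ x' := by
    ext w
    exact (f H).injective (hev w)
  rw [hφ this]

/-- Permute the components of a star forest and flip each of them. -/
def starForestAut {α β : Type*} (p : (Equiv.Perm α × Equiv.Perm β) ×
    ((α → Equiv.Perm Bool) × (β → Equiv.Perm Bool))) : starForest α β ≃g starForest α β where
  toEquiv := Equiv.sumCongr (Equiv.prodShear p.1.1 fun i => Equiv.optionCongr (p.2.1 i))
    (Equiv.prodShear p.1.2 p.2.2)
  map_rel_iff' := by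
    rintro (⟨i, _ | b⟩ | ⟨j, b⟩) (⟨i', _ | b'⟩ | ⟨j', b'⟩) <;>
      simp [starForest]
    rintro rfl
    simp

theorem starForestAut_injective {α β : Type*} :
    Function.Injective (starForestAut (α := α) (β := β)) := by
  rintro ⟨⟨σ, τ⟩, a, b⟩ ⟨⟨σ', τ'⟩, a', b'⟩ h
  have h1 : ∀ i o, (σ i, (a i).optionCongr o) = (σ' i, (a' i).optionCongr o) := fun i o =>
    Sum.inl_injective (DFunLike.congr_fun h (Sum.inl (i, o)))
  have h2 : ∀ j c, (τ j, b j c) = (τ' j, b' j c) := fun j c =>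
    Sum.inr_injective (DFunLike.congr_fun h (Sum.inr (j, c)))
  simp only [Prod.mk.injEq]
  refine ⟨⟨Equiv.ext fun i => (Prod.ext_iff.1 (h1 i none)).1,
    Equiv.ext fun j => (Prod.ext_iff.1 (h2 j true)).1⟩,
    funext fun i => Equiv.ext fun c => ?_,
    funext fun j => Equiv.ext fun c => (Prod.ext_iff.1 (h2 j c)).2⟩
  simpa using (Prod.ext_iff.1 (h1 i (some c))).2

/-- Bounds the number of automorphisms in `starForestAut` below by a quantity that depends on `t +
s` only; it is the estimate `choose ≤ 2 ^ (t + s)`. -/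
theorem factorial_add_le (t s : ℕ) :
    (t + s).factorial ≤ t.factorial * s.factorial * (2 ^ t * 2 ^ s) := by
  rw [← Nat.add_choose_mul_factorial_mul_factorial t s, ← pow_add, mul_assoc, mul_comm]
  exact Nat.mul_le_mul_left _ (Nat.choose_le_two_pow _ _)

theorem card_mul_factorial_le_of_isShortStarCover {n : ℕ} (𝒮 : Finset (SimpleGraph (Fin n)))
    (h𝒮 : ∀ H ∈ 𝒮, IsShortStarCover H) :
    𝒮.card * (n / 3).factorial ≤ (n / 3 + 1) * n.factorial := by
  classical
  let F : ℕ → Finset (SimpleGraph (Fin n)) := fun t =>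
    𝒮.filter fun H => Nonempty (starForest (Fin t) (Fin ((n - 3 * t) / 2)) ≃g H)
  have hcov : 𝒮 ⊆ (Finset.range (n / 3 + 1)).biUnion F := by
    intro H hH
    obtain ⟨t, s, ⟨e⟩⟩ := (h𝒮 H hH).exists_iso_starForest
    have hc := Fintype.card_congr e.toEquiv
    simp only [Fintype.card_sum, Fintype.card_prod, Fintype.card_fin, Fintype.card_option,
      Fintype.card_bool] at hc
    have hs : s = (n - 3 * t) / 2 := by omega
    subst hs
    simp only [Finset.mem_biUnion, Finset.mem_range, F, Finset.mem_filter]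
    exact ⟨t, by omega, hH, ⟨e⟩⟩
  have hF : ∀ t ∈ Finset.range (n / 3 + 1), (F t).card * (n / 3).factorial ≤ n.factorial := by
    intro t ht
    rw [Finset.mem_range] at ht
    have h := card_mul_card_le_factorial (starForestAut_injective (α := Fin t)
      (β := Fin ((n - 3 * t) / 2))) (F t) (fun H hH => (Finset.mem_filter.1 hH).2)
    simp only [Fintype.card_prod, Fintype.card_perm, Fintype.card_fun, Fintype.card_fin,
      Fintype.card_bool, Nat.factorial_two] at h
    -- If `n - 3 * t` is odd, the truncated division gives the wrong vertex count and the class is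
    -- empty. Otherwise `3t + 2s = n`, so `n / 3 ≤ t + s`.
    rcases (F t).eq_empty_or_nonempty with h0 | ⟨H, hH⟩
    · simp [h0]
    obtain ⟨e⟩ := (Finset.mem_filter.1 hH).2
    have hc := Fintype.card_congr e.toEquiv
    simp only [Fintype.card_sum, Fintype.card_prod, Fintype.card_fin, Fintype.card_option,
      Fintype.card_bool] at hc
    refine le_trans (Nat.mul_le_mul_left _ ?_) h
    exact (Nat.factorial_le (by omega)).trans (factorial_add_le _ _)
  calc 𝒮.card * (n / 3).factorial
      ≤ (∑ t ∈ Finset.range (n / 3 + 1), (F t).card) * (n / 3).factorial :=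
        Nat.mul_le_mul_right _ ((Finset.card_le_card hcov).trans Finset.card_biUnion_le)
    _ ≤ ∑ _t ∈ Finset.range (n / 3 + 1), n.factorial := by
        rw [Finset.sum_mul]; exact Finset.sum_le_sum hF
    _ = (n / 3 + 1) * n.factorial := by simp

theorem R_mul_factorial_le (n : ℕ) : R n * (n / 3).factorial ≤ (n / 3 + 1) * n.factorial := by
  classical
  obtain ⟨𝒢, h2, h4, hcard⟩ :=
    (maxFamily_isGreatest n (twoRegularGraphs n) (maxDegreeAtLeastFour n)).1
  have hex : ∀ G ∈ 𝒢, ∃ H ≤ G, IsShortStarCover H := fun G hG => by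
    have hr := mem_twoRegularGraphs.1 (h2 hG)
    refine exists_isShortStarCover_le G (fun v => ?_) (fun v => (hr v).le)
    have : 0 < (G.neighborSet v).ncard := by rw [hr]; norm_num
    exact (Set.ncard_pos).1 this
  choose! c hle hc using hex
  have hinj : Set.InjOn c 𝒢 := by
    intro A hA B hB hAB
    by_contra hne
    obtain ⟨v, hv⟩ := (sup_mem_maxDegreeAtLeastFour (h2 hA) (h2 hB)).1 (h4 A hA B hB hne)
    obtain ⟨u, hu⟩ := (hc A hA).exists_adj v
    exact hv u ⟨hle A hA hu, hle B hB (hAB ▸ hu)⟩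
  have hR : R n = (𝒢.image c).card := by rw [Finset.card_image_of_injOn hinj, hcard, R]
  rw [hR]
  refine card_mul_factorial_le_of_isShortStarCover _ fun H hH => ?_
  obtain ⟨G, hG, rfl⟩ := Finset.mem_image.1 hH
  exact hc G hG

theorem R_le (n : ℕ) : (R n : ℝ) ≤
    Real.exp (Real.sqrt (n : ℝ)) * ((n.factorial : ℝ) / ((n / 3 : ℕ).factorial : ℝ)) := by
  have h : (R n : ℝ) * ((n / 3 : ℕ).factorial : ℝ) ≤ ((n / 3 : ℕ) + 1 : ℝ) * n.factorial := by
    exact_mod_cast R_mul_factorial_le n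
  -- At `x = √n`, `1 + x + x²/2 ≤ e^x` gives `n/3 + 1 ≤ e^√n`.
  have hq := Real.quadratic_le_exp_of_nonneg (Real.sqrt_nonneg (n : ℝ))
  rw [Real.sq_sqrt (Nat.cast_nonneg n)] at hq
  have hd : ((n / 3 : ℕ) : ℝ) ≤ (n : ℝ) / 3 := Nat.cast_div_le
  have hs := Real.sqrt_nonneg (n : ℝ)
  have hn : (0 : ℝ) ≤ n := Nat.cast_nonneg n
  rw [← mul_div_assoc, le_div_iff₀ (by positivity)]
  refine h.trans (mul_le_mul_of_nonneg_right ?_ (by positivity))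
  linarith

/-! ### Lower bound: conflicts between labelings of triangles and 4-cycles -/

/-- The disjoint union of triangles indexed by `α` and 4-cycles indexed by `β`. -/
def cycleForest (α β : Type*) : SimpleGraph (α × Fin 3 ⊕ β × Fin 4) where
  Adj
    | .inl p, .inl q => p.1 = q.1 ∧ p.2 ≠ q.2
    | .inr p, .inr q => p.1 = q.1 ∧ (q.2 = p.2 + 1 ∨ p.2 = q.2 + 1)
    | _, _ => False
  symm := ⟨by rintro (p | p) (q | q) h <;> simp_all [eq_comm, or_comm]⟩
  loopless := ⟨by rintro (p | p) <;> simp⟩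

theorem cycleForest_ncard {α β : Type*} (x : α × Fin 3 ⊕ β × Fin 4) :
    ((cycleForest α β).neighborSet x).ncard = 2 := by
  rw [Set.ncard_eq_two]
  rcases x with ⟨i, a⟩ | ⟨j, a⟩
  · refine ⟨.inl (i, a + 1), .inl (i, a + 2), ?_, Set.ext ?_⟩
    · simp
    · have : ∀ a b : Fin 3, a ≠ b ↔ b = a + 1 ∨ b = a + 2 := by decide
      rintro (⟨i', b⟩ | ⟨j', b⟩)
      · simp only [mem_neighborSet, cycleForest, this, Set.mem_insert_iff, Set.mem_singleton_iff,
          Sum.inl.injEq, Prod.mk.injEq]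
        tauto
      · simp [cycleForest]
  · refine ⟨.inr (j, a + 1), .inr (j, a + 3), ?_, Set.ext ?_⟩
    · simp
    · have : ∀ a b : Fin 4, (b = a + 1 ∨ a = b + 1) ↔ b = a + 1 ∨ b = a + 3 := by decide
      rintro (⟨i', b⟩ | ⟨j', b⟩)
      · simp [cycleForest]
      · simp only [mem_neighborSet, cycleForest, this, Set.mem_insert_iff, Set.mem_singleton_iff,
          Sum.inr.injEq, Prod.mk.injEq]
        tauto

/-- Every color used has at least two of the three points, so there is room for only one color. -/
theorem eq_apply_zero_of_forall_exists_ne {γ : Type*} (c : Fin 3 → γ)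
    (h : ∀ a, ∃ b, b ≠ a ∧ c a = c b) (a : Fin 3) : c a = c 0 := by
  revert a
  simp only [Fin.exists_fin_succ, Fin.forall_fin_succ] at h ⊢
  simp at h ⊢
  grind

/-- A permutation under which every vertex keeps a neighbor maps triangles to triangles. -/
theorem cycleForest_triangle_preserved {α β : Type*}
    {π : Equiv.Perm (α × Fin 3 ⊕ β × Fin 4)}
    (hπ : ∀ v, ∃ u, (cycleForest α β).Adj v u ∧ (cycleForest α β).Adj (π v) (π u)) (i : α) :
    ∃ i', ∀ a, ∃ b, π (.inl (i, a)) = .inl (i', b) := by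
  let comp : α × Fin 3 ⊕ β × Fin 4 → α ⊕ β := Sum.map Prod.fst Prod.fst
  have hcomp : ∀ {x y}, (cycleForest α β).Adj x y → comp x = comp y := by
    rintro (x | x) (y | y) h
    · exact congrArg Sum.inl h.1
    · exact h.elim
    · exact h.elim
    · exact congrArg Sum.inr h.1
  have hnext : ∀ a : Fin 3, ∃ b, b ≠ a ∧ comp (π (.inl (i, a))) = comp (π (.inl (i, b))) := by
    intro a
    obtain ⟨u, h1, h2⟩ := hπ (.inl (i, a))
    rcases u with ⟨i', b⟩ | u
    · obtain ⟨h, hab⟩ := h1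
      obtain rfl : i = i' := h
      exact ⟨b, Ne.symm hab, hcomp h2⟩
    · exact h1.elim
  have hsame : ∀ a, comp (π (.inl (i, a))) = comp (π (.inl (i, 0))) :=
    eq_apply_zero_of_forall_exists_ne (fun a => comp (π (.inl (i, a)))) hnext
  rcases hc : comp (π (.inl (i, 0))) with i' | j
  · refine ⟨i', fun a => ?_⟩
    have h := (hsame a).trans hc
    rcases hx : π (.inl (i, a)) with ⟨i'', b⟩ | x
    · rw [hx] at h
      obtain rfl : i'' = i' := Sum.inl_injective h
      exact ⟨b, rfl⟩
    · rw [hx] at h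
      exact (Sum.inr_ne_inl h).elim
  · exfalso
    have hf : ∀ a, ∃ b, π (.inl (i, a)) = .inr (j, b) := fun a => by
      have h := (hsame a).trans hc
      rcases hx : π (.inl (i, a)) with x | ⟨j', b⟩
      · rw [hx] at h
        exact (Sum.inl_ne_inr h).elim
      · rw [hx] at h
        obtain rfl : j' = j := Sum.inr_injective h
        exact ⟨b, rfl⟩
    choose f hf using hf
    have f_inj : Function.Injective f := fun a a' h => by
      have : π (.inl (i, a)) = π (.inl (i, a')) := by rw [hf, hf, h]
      simpa using π.injective this
    have key : ∀ f : Fin 3 → Fin 4, Function.Injective f →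
        ∃ d, (∀ a, f a ≠ d) ∧ ∀ x, x ≠ d → ∃ a, f a = x := by
      intro f hf
      have hcard : (Finset.univ.image f)ᶜ.card = 1 := by
        rw [Finset.card_compl, Finset.card_image_of_injective _ hf]; rfl
      obtain ⟨d, hd⟩ := Finset.card_eq_one.1 hcard
      have hd' : ∀ x, (∀ a, f a ≠ x) ↔ x = d := fun x => by
        rw [← Finset.mem_singleton, ← hd]; simp
      refine ⟨d, (hd' d).2 rfl, fun x hx => ?_⟩
      by_contra! h
      exact hx ((hd' x).1 h)
    -- If the triangle lands in a 4-cycle, it misses one vertex `d`. The preimage `w` of `d` keeps a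
    -- neighbor, whose image is adjacent to `d` and hence lies in the image of the triangle. So that
    -- neighbor, and with it `w`, belongs to the triangle, although `d` was missed.
    obtain ⟨d, hd, hd'⟩ := key f f_inj
    obtain ⟨w, hw⟩ := π.surjective (.inr (j, d))
    obtain ⟨u, h1, h2⟩ := hπ w
    rw [hw] at h2
    rcases hu : π u with x | ⟨j', x⟩
    · rw [hu] at h2; exact h2.elim
    rw [hu] at h2
    obtain rfl : j = j' := h2.1
    have hxd : x ≠ d := by
      rintro rfl
      exact h2.ne rfl
    obtain ⟨a, rfl⟩ := hd' x hxd
    rw [← hf a] at hu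
    obtain rfl := π.injective hu
    rcases w with ⟨i', b⟩ | w
    · obtain rfl : i' = i := h1.1
      rw [hf b] at hw
      have := Sum.inr_injective hw
      exact hd b (Prod.ext_iff.1 this).2
    · exact h1.elim

/-- By finiteness the triangles are permuted and filled completely, so the remaining points map
among themselves. The 4-cycle structure is ignored there, which costs only the factor `(4r)!`. -/
theorem exists_eq_sumCongr_of_triangle_preserved {α β : Type*} [Finite α] [Finite β]
    {π : Equiv.Perm (α × Fin 3 ⊕ β × Fin 4)}
    (hπ : ∀ i, ∃ i', ∀ a, ∃ b, π (.inl (i, a)) = .inl (i', b)) :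
    ∃ (σ : Equiv.Perm α) (τ : α → Equiv.Perm (Fin 3)) (ρ : Equiv.Perm (β × Fin 4)),
      Equiv.sumCongr (Equiv.prodShear σ τ) ρ = π := by
  choose σ τ hπ using hπ
  have τ_inj : ∀ i, Function.Injective (τ i) := fun i a a' h => by
    have : π (.inl (i, a)) = π (.inl (i, a')) := by rw [hπ, hπ, h]
    simpa using π.injective this
  have τ_bij := fun i => Finite.injective_iff_bijective.1 (τ_inj i)
  have σ_inj : Function.Injective σ := fun i i' h => by
    obtain ⟨a, ha⟩ := (τ_bij i).2 0
    obtain ⟨a', ha'⟩ := (τ_bij i').2 0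
    have : π (.inl (i, a)) = π (.inl (i', a')) := by rw [hπ, hπ, h, ha, ha']
    have := π.injective this
    simp only [Sum.inl.injEq, Prod.mk.injEq] at this
    exact this.1
  have σ_bij := Finite.injective_iff_bijective.1 σ_inj
  have hρ : ∀ x, ∃ y, π (.inr x) = .inr y := fun x => by
    rcases hx : π (.inr x) with ⟨i', b⟩ | y
    · obtain ⟨i, rfl⟩ := σ_bij.2 i'
      obtain ⟨a, rfl⟩ := (τ_bij i).2 b
      rw [← hπ] at hx
      exact (Sum.inr_ne_inl (π.injective hx)).elim
    · exact ⟨y, rfl⟩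
  choose ρ hρ using hρ
  have ρ_inj : Function.Injective ρ := fun x x' h => by
    have : π (.inr x) = π (.inr x') := by rw [hρ, hρ, h]
    simpa using π.injective this
  refine ⟨Equiv.ofBijective σ σ_bij, fun i => Equiv.ofBijective _ (τ_bij i),
    Equiv.ofBijective ρ (Finite.injective_iff_bijective.1 ρ_inj), Equiv.ext ?_⟩
  rintro (⟨i, a⟩ | x)
  · simp [hπ]
  · simp [hρ]

/-- A maximality (Gilbert–Varshamov) argument: the labelings conflicting with members of a maximal
conflict-free set `E` exhaust all `n!` labelings. -/
theorem factorial_le_R_mul {n k r : ℕ} (hn : n = 3 * k + 4 * r) :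
    n.factorial ≤ R n * (k.factorial * 6 ^ k * (4 * r).factorial) := by
  classical
  let V := Fin k × Fin 3 ⊕ Fin r × Fin 4
  let G₀ : SimpleGraph V := cycleForest (Fin k) (Fin r)
  have hV : Fintype.card V = n := by simp [V, hn]; ring
  let e₀ : Fin n ≃ V := (Fintype.equivFinOfCardEq hV).symm
  let G : (Fin n ≃ V) → SimpleGraph (Fin n) := fun e => G₀.comap e
  have hG : ∀ e, G e ∈ twoRegularGraphs n := fun e => mem_twoRegularGraphs.2 fun v => by
    have : (G e).neighborSet v = e ⁻¹' (G₀.neighborSet (e v)) := rfl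
    rw [this, Set.ncard_preimage_of_injective_subset_range e.injective
      (by rw [e.surjective.range_eq]; exact Set.subset_univ _)]
    exact cycleForest_ncard _
  let bad : (Fin n ≃ V) → (Fin n ≃ V) → Prop := fun e e' =>
    ∀ v, ∃ u, (G e).Adj v u ∧ (G e').Adj v u
  have bad_symm : ∀ e e', bad e e' → bad e' e := fun e e' h v =>
    (h v).imp fun u hu => hu.symm
  -- Labelings of the same graph count as conflicting, so distinct members of `E` give distinct
  -- graphs.
  have bad_self : ∀ e e', G e = G e' → bad e e' := fun e e' h v => by
    have h2 := mem_twoRegularGraphs.1 (hG e) v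
    have h0 : 0 < ((G e).neighborSet v).ncard := by omega
    obtain ⟨u, hu⟩ := (Set.ncard_pos).1 h0
    exact ⟨u, hu, h ▸ hu⟩
  obtain ⟨E, hE⟩ := (Set.toFinite {E : Finset (Fin n ≃ V) |
    ∀ e ∈ E, ∀ e' ∈ E, e ≠ e' → ¬ bad e e'}).exists_maximal ⟨∅, by simp⟩
  have hEp := hE.prop
  have hcover : ∀ g, ∃ e ∈ E, bad e g := by
    intro g
    by_contra! hc
    have hg : g ∉ E := fun h => hc g h (bad_self g g rfl)
    refine hg (hE.le_of_ge (y := insert g E) ?_ (Finset.subset_insert g E)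
      (Finset.mem_insert_self g E))
    intro e he e' he' hne
    rcases Finset.mem_insert.1 he with h1 | h1 <;> rcases Finset.mem_insert.1 he' with h2 | h2
    · exact absurd (h1.trans h2.symm) hne
    · exact fun h => hc e' h2 (bad_symm _ _ (h1 ▸ h))
    · exact h2 ▸ hc e h1
    · exact hEp e h1 e' h2 hne
  have hinj : Set.InjOn G E := fun e he e' he' h => by
    by_contra hne
    exact hEp e he e' he' hne (bad_self _ _ h)
  have hER : E.card ≤ R n := by
    refine (maxFamily_isGreatest n (twoRegularGraphs n) (maxDegreeAtLeastFour n)).2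
      ⟨E.image G, ?_, ?_, Finset.card_image_of_injOn hinj⟩
    · intro A hA
      obtain ⟨e, -, rfl⟩ := Finset.mem_image.1 hA
      exact hG e
    · intro A hA B hB hne
      obtain ⟨e, he, rfl⟩ := Finset.mem_image.1 hA
      obtain ⟨e', he', rfl⟩ := Finset.mem_image.1 hB
      rw [sup_mem_maxDegreeAtLeastFour (hG e) (hG e')]
      have := hEp e he e' he' (fun h => hne (h ▸ rfl))
      simpa [bad] using this
  let X := Equiv.Perm (Fin k) × (Fin k → Equiv.Perm (Fin 3)) × Equiv.Perm (Fin r × Fin 4)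
  let Φ : (Fin n ≃ V) × X → (Fin n ≃ V) := fun p =>
    p.1.trans (Equiv.sumCongr (Equiv.prodShear p.2.1 p.2.2.1) p.2.2.2)
  have hsurj : (Finset.univ : Finset (Fin n ≃ V)) ⊆ (E ×ˢ (Finset.univ : Finset X)).image Φ := by
    intro g _
    obtain ⟨e, he, hb⟩ := hcover g
    have hπ : ∀ v, ∃ u, G₀.Adj v u ∧ G₀.Adj ((e.symm.trans g) v) ((e.symm.trans g) u) := fun v => by
      obtain ⟨u, h1, h2⟩ := hb (e.symm v)
      refine ⟨e u, ?_, ?_⟩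
      · simpa [G] using h1
      · simpa [G] using h2
    obtain ⟨σ, τ, ρ, h⟩ := exists_eq_sumCongr_of_triangle_preserved
      (cycleForest_triangle_preserved hπ)
    refine Finset.mem_image.2 ⟨(e, σ, τ, ρ), by simp [he], ?_⟩
    ext v
    simp only [Φ, h, Equiv.trans_apply, Equiv.symm_apply_apply]
  have hcard := (Finset.card_le_card hsurj).trans Finset.card_image_le
  rw [Finset.card_univ, Fintype.card_equiv e₀, Finset.card_product, Finset.card_univ] at hcard
  simp only [X, Fintype.card_prod, Fintype.card_perm, Fintype.card_fun, Fintype.card_fin] at hcard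
  refine hcard.trans (Nat.mul_le_mul hER (le_of_eq ?_))
  rw [show Nat.factorial 3 = 6 from rfl, mul_comm r 4, mul_assoc]

/-! ### The constants in the lower bound -/

/-- 5 is the only `n ≥ 3` not of the form `3k + 4r`, so it needs its own construction. -/
theorem one_le_R_five : 1 ≤ R 5 := by
  classical
  refine (maxFamily_isGreatest 5 (twoRegularGraphs 5) (maxDegreeAtLeastFour 5)).2
    ⟨{cycleGraph 5}, ?_, by simp, by simp⟩
  simp only [Finset.coe_singleton, Set.singleton_subset_iff]
  refine mem_twoRegularGraphs.2 fun v => ?_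
  rw [← Nat.card_coe_set_eq, Nat.card_eq_fintype_card, card_neighborSet_eq_degree]
  exact cycleGraph_degree_three_le

theorem le_R_of_eq {n k r : ℕ} (hn : n = 3 * k + 4 * r) :
    (n.factorial : ℝ) / ((4 * r).factorial * ((n / 3 : ℕ).factorial * (6 : ℝ) ^ ((n : ℝ) / 3)))
      ≤ R n := by
  have h : (n.factorial : ℝ) ≤ R n * (k.factorial * 6 ^ k * (4 * r).factorial) := by
    exact_mod_cast factorial_le_R_mul hn
  rw [div_le_iff₀ (by positivity)]
  refine h.trans (mul_le_mul_of_nonneg_left ?_ (by positivity))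
  rw [mul_comm]
  refine mul_le_mul_of_nonneg_left (mul_le_mul ?_ ?_ (by positivity) (by positivity))
    (by positivity)
  · exact_mod_cast Nat.factorial_le (by omega)
  · rw [← Real.rpow_natCast]
    refine Real.rpow_le_rpow_of_exponent_le (by norm_num) ?_
    rw [hn]; push_cast
    linarith [Nat.cast_nonneg (α := ℝ) r]

theorem mul_le_R {n : ℕ} (hn : 3 ≤ n) :
    1 / ((8).factorial : ℝ) *
      ((n.factorial : ℝ) / (((n / 3 : ℕ).factorial : ℝ) * (6 : ℝ) ^ ((n : ℝ) / 3))) ≤ R n := by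
  rcases eq_or_ne n 5 with rfl | h5
  · have h1 : (1 : ℝ) ≤ R 5 := by exact_mod_cast one_le_R_five
    refine le_trans ?_ h1
    rw [div_mul_div_comm, one_mul]
    refine div_le_one_of_le₀ ?_ (by positivity)
    have h6 : (1 : ℝ) ≤ (6 : ℝ) ^ (((5 : ℕ) : ℝ) / 3) :=
      Real.one_le_rpow (by norm_num) (by positivity)
    norm_num [Nat.factorial] at h6 ⊢
    linarith
  -- Since `4 ≡ 1` mod 3, `r = n % 3` works. Then `4r ≤ 8`, whence the constant `1 / 8!`.
  · obtain ⟨k, r, hr, h⟩ : ∃ k r, r ≤ 2 ∧ n = 3 * k + 4 * r :=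
      ⟨(n - 4 * (n % 3)) / 3, n % 3, by omega, by omega⟩
    refine le_trans ?_ (le_R_of_eq h)
    rw [div_mul_div_comm, one_mul]
    gcongr
    omega

theorem theorem2 :
    (∃ c : ℝ, 0 < c ∧ ∀ n : ℕ, 3 ≤ n →
      c * ((n.factorial : ℝ) / (((n / 3 : ℕ).factorial : ℝ) * (6 : ℝ) ^ ((n : ℝ) / 3)))
        ≤ (R n : ℝ)) ∧
    (∀ n : ℕ, 3 ∣ n →
      (n.factorial : ℝ) / (((n / 3 : ℕ).factorial : ℝ) * (6 : ℝ) ^ ((n : ℝ) / 3))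
        ≤ (R n : ℝ)) ∧
    (∀ n : ℕ,
      (R n : ℝ) ≤
        Real.exp (Real.sqrt (n : ℝ)) * ((n.factorial : ℝ) / ((n / 3 : ℕ).factorial : ℝ))) := by
  refine ⟨⟨1 / ((8).factorial : ℝ), by positivity, fun n hn => mul_le_R hn⟩, ?_, R_le⟩
  rintro n ⟨k, hk⟩
  simpa using le_R_of_eq (n := n) (k := k) (r := 0) (by omega)
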